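/- Notation. For a real matrix $A$ write $\|A\|_{F,2}=(\sum_{i,j}|A_{ij}|^2)^{1/2}$ and $\|A\|_{F,1}=\sum_{i,j}|A_{ij}|$. For a real $M\times N$ matrix $Y$, an integer $p\ge 1$, parameters $\alpha,\nu,\gamma\ge 0$ and entrywise nonnegative matrices $U\in\mathbb{R}^{M\times p}$, $\Sigma\in\mathbb{R}^{p\times p}$, $V\in\mathbb{R}^{p\times N}$ put $$J_p(U,\Sigma,V)=\|Y-U\Sigma V\|_{F,2}^2+\gamma\|\Sigma\|_{F,1}+\nu\|U\|_{F,1}+\nu\|V\|_{F,1}+\alpha\|U^TU-I_p\|_{F,1}+\alpha\|VV^T-I_p\|_{F,1},$$ and let $J_p(\tilde U_p,\tilde\Sigma_p,\tilde V_p)$ denote the minimal value (infimum) of $J_p$ over all such nonnegative triples, i.e. its value at a minimizer $(\tilde U_p,\tilde\Sigma_p,\tilde V_p)$ whenever one exists. For $N,M\in\mathbb{N}$, $K>1$, $\delta>0$, $C_3>0$ and $l\in\mathbb{R}$ put $$\varepsilon=\frac{\delta}{KNM+\min(N,M)^2},\qquad \mu(N,M,l)=\frac{l(l-1)}{2}+MN-|N-M|-1,\qquad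 p_{N,M,\delta}=\sqrt{\frac{\max(M,N)}{|\log(C_3\varepsilon)|}}.$$ **Theorem.** Let $0<C_1<C_2<\infty$. There exist constants $C_3>0$ and $\delta_0>0$, depending only on $C_1,C_2$, such that the following holds. (i) Let $N,M\ge 2$ be integers, $K>1$ and $0<\delta<\delta_0$. Then $$p_{N,M,\delta}=\sqrt{\frac{\max(M,N)}{\log(KNM+\min(M,N)^2)+|\log\delta|-\log C_3}}.$$ Moreover, let $\alpha,\nu,\gamma\ge 0$ satisfy $\gamma+2\nu\le (K-1)\varepsilon$, and let $Y$ be a random $M\times N$ matrix whose rows are i.i.d. random vectors in $[0,1]^N$ with common distribution $f\,dx$, where $f$ is measurable and $C_1<f<C_2$ on $[0,1]^N$. Then $$\mathbb{P}\Big(\min_{1\le p\le \min(N,M)} J_p(\tilde U_p,\tilde\Sigma_p,\tilde V_p)<\delta\Big)\ \ge\ \min(N,M)\;p_{N,M,\delta}^{\,\max(N,M)}\,(C_3\varepsilon)^{\mu(N,M,p_{N,M,\delta})}.$$ (ii) For all fixed $K>1$ and $\delta>0$ one has $p_{N,N,\delta}\sim\sqrt{N/(2\log N)}$ as $N\to\infty$.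 -/

import Mathlib

open MeasureTheory ProbabilityTheory Filter Asymptotics
open scoped Matrix

noncomputable section

namespace TriFactorization

/-- The Frobenius norm `‖A‖_{F,2}`. -/
def frobNorm {m n : ℕ} (A : Matrix (Fin m) (Fin n) ℝ) : ℝ :=
  Real.sqrt (∑ i, ∑ j, |A i j| ^ 2)

/-- The entrywise `ℓ¹` norm `‖A‖_{F,1}`. -/
def entryNorm {m n : ℕ} (A : Matrix (Fin m) (Fin n) ℝ) : ℝ :=
  ∑ i, ∑ j, |A i j|

/-- Matrices with nonnegative entries. -/
def IsNonneg {m n : ℕ} (A : Matrix (Fin m) (Fin n) ℝ) : Prop :=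
  ∀ i j, 0 ≤ A i j

/-- The tri-factorization functional of the data matrix `Y`. The columns of `U` and the rows of
`V` are the basis vectors, so both Gram matrices `UᵀU` and `VVᵀ` are `p × p`. -/
def J {M N p : ℕ} (α ν γ : ℝ) (Y : Matrix (Fin M) (Fin N) ℝ)
    (U : Matrix (Fin M) (Fin p) ℝ) (S : Matrix (Fin p) (Fin p) ℝ)
    (V : Matrix (Fin p) (Fin N) ℝ) : ℝ :=
  frobNorm (Y - U * S * V) ^ 2 + γ * entryNorm S + ν * entryNorm U + ν * entryNorm V
    + α * entryNorm (Uᵀ * U - 1) + α * entryNorm (V * Vᵀ - 1)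

/-- `(U, S, V)` minimizes the functional among nonnegative triples of inner dimension `p`. -/
def IsMinimizer {M N p : ℕ} (α ν γ : ℝ) (Y : Matrix (Fin M) (Fin N) ℝ)
    (U : Matrix (Fin M) (Fin p) ℝ) (S : Matrix (Fin p) (Fin p) ℝ)
    (V : Matrix (Fin p) (Fin N) ℝ) : Prop :=
  IsNonneg U ∧ IsNonneg S ∧ IsNonneg V ∧
    ∀ (U' : Matrix (Fin M) (Fin p) ℝ) (S' : Matrix (Fin p) (Fin p) ℝ)
      (V' : Matrix (Fin p) (Fin N) ℝ), IsNonneg U' → IsNonneg S' → IsNonneg V' →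
      J α ν γ Y U S V ≤ J α ν γ Y U' S' V'

/-- The minimal value of the functional over nonnegative triples of inner dimension `p`
(the infimum, so that it also makes sense when no minimizer exists). -/
def minValue {M N : ℕ} (α ν γ : ℝ) (Y : Matrix (Fin M) (Fin N) ℝ) (p : ℕ) : ℝ :=
  sInf {r | ∃ (U : Matrix (Fin M) (Fin p) ℝ) (S : Matrix (Fin p) (Fin p) ℝ)
    (V : Matrix (Fin p) (Fin N) ℝ),
    IsNonneg U ∧ IsNonneg S ∧ IsNonneg V ∧ r = J α ν γ Y U S V}

/-- At a minimizer the functional takes the value `minValue`. -/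
theorem IsMinimizer.eq_minValue {M N p : ℕ} {α ν γ : ℝ} {Y : Matrix (Fin M) (Fin N) ℝ}
    {U : Matrix (Fin M) (Fin p) ℝ} {S : Matrix (Fin p) (Fin p) ℝ}
    {V : Matrix (Fin p) (Fin N) ℝ} (h : IsMinimizer α ν γ Y U S V) :
    J α ν γ Y U S V = minValue α ν γ Y p := by
  obtain ⟨hU, hS, hV, hmin⟩ := h
  symm
  unfold minValue
  apply IsLeast.csInf_eq
  refine ⟨⟨U, S, V, hU, hS, hV, rfl⟩, ?_⟩
  rintro r ⟨U', S', V', hU', hS', hV', rfl⟩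
  exact hmin U' S' V' hU' hS' hV'

/-- The minimum over the inner dimension `1 ≤ p ≤ min(N, M)` of the minimal values. -/
def minOverRank {M N : ℕ} (α ν γ : ℝ) (Y : Matrix (Fin M) (Fin N) ℝ) : ℝ :=
  ⨅ p : Finset.Icc 1 (min N M), minValue α ν γ Y (p : ℕ)

/-- The exponent `μ(N, M, l)`, for real `l`. -/
def mu (N M : ℕ) (l : ℝ) : ℝ :=
  l * (l - 1) / 2 + (M : ℝ) * N - |(N : ℝ) - M| - 1

/-- `ε = δ (K N M + min(N, M)²)⁻¹`. -/
def eps (K : ℝ) (N M : ℕ) (δ : ℝ) : ℝ :=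
  δ * (K * N * M + (min N M : ℕ) ^ 2)⁻¹

/-- The choice `p_{N,M,δ} = √(max(M, N) / |log (C₃ ε)|)`, a real number. -/
def rankChoice (C₃ K : ℝ) (N M : ℕ) (δ : ℝ) : ℝ :=
  Real.sqrt ((max M N : ℕ) / |Real.log (C₃ * eps K N M δ)|)

end TriFactorization

end

open MeasureTheory ProbabilityTheory Filter Asymptotics
open scoped Matrix

namespace TriFactorization

/-! Rank one already suffices. If `Y` is entrywise within `√ε` of `x i * y j` with entries of `x`,
`y` in `[0,1]`, normalising both vectors puts the scale into `S` and kills the orthogonality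
penalties, so the functional is at most `(ε + γ + 2ν)MN ≤ KεMN < δ` (`minOverRank_le_rank_one`).

Such `Y` are produced by a grid of mesh `1/q ≈ √ε`: choose one cell per index of the longer
dimension and repeat it along the shorter one. The `q ^ max N M` choices give disjoint events, each
of probability at least `(c / q ^ N) ^ M`, where `c = min C₁ 1` bounds the density from below
(`card_mul_le_measureReal_gridBox`).

The total is at least `c ^ max * (√ε / 2) ^ (max * (min - 1))`. The claimed bound has `ε` instead of
`√ε` and an exponent at least as large, and the spare power of `√ε` absorbs the prefactor `min * p ^
max` (`rank_bound_le`). -/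

/-! ### Deterministic bound by rank one factorizations -/

/-- A nonnegative vector with entries at most `1` is a bounded multiple of a nonnegative unit
vector. -/
theorem exists_unit_direction {M : ℕ} (hM : 0 < M) (x : Fin M → ℝ) (h0 : ∀ i, 0 ≤ x i)
    (h1 : ∀ i, x i ≤ 1) :
    ∃ (s : ℝ) (u : Fin M → ℝ), 0 ≤ s ∧ s ≤ M ∧ (∀ i, 0 ≤ u i) ∧ ∑ i, u i * u i = 1 ∧
      ∀ i, x i = s * u i := by
  have hsum : 0 ≤ ∑ i, x i * x i := Finset.sum_nonneg fun i _ => mul_self_nonneg _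
  rcases hsum.eq_or_lt with hz | hpos
  -- The zero vector has no direction: any coordinate vector serves, with scale `0`.
  · refine ⟨0, Pi.single ⟨0, hM⟩ 1, le_rfl, by positivity, fun i => ?_, ?_, fun i => ?_⟩
    · by_cases hi : i = ⟨0, hM⟩ <;> simp [hi]
    · simp [Pi.single_apply]
    · have := (Finset.sum_eq_zero_iff_of_nonneg fun i _ => mul_self_nonneg (x i)).1 hz.symm i
        (Finset.mem_univ i)
      simpa using this
  · have hs : 0 < Real.sqrt (∑ i, x i * x i) := Real.sqrt_pos.2 hpos
    refine ⟨Real.sqrt (∑ i, x i * x i), fun i => x i / Real.sqrt (∑ i, x i * x i), hs.le, ?_,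
      fun i => div_nonneg (h0 i) hs.le, ?_, fun i => ?_⟩
    · have hM1 : (1 : ℝ) ≤ M := by exact_mod_cast hM
      have hle : ∑ i, x i * x i ≤ M := by
        calc ∑ i, x i * x i ≤ ∑ _i : Fin M, (1 : ℝ) :=
              Finset.sum_le_sum fun i _ => mul_le_one₀ (h1 i) (h0 i) (h1 i)
          _ = M := by simp
      exact Real.sqrt_le_iff.2 ⟨by positivity, by nlinarith⟩
    · simp_rw [div_mul_div_comm, Real.mul_self_sqrt hsum, ← Finset.sum_div]
      exact div_self hpos.ne'
    · rw [mul_div_cancel₀ _ hs.ne']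

theorem le_one_of_sum_mul_self {M : ℕ} {u : Fin M → ℝ} (hu : ∑ i, u i * u i = 1) (i : Fin M) :
    u i ≤ 1 := by
  have : u i * u i ≤ ∑ i, u i * u i :=
    Finset.single_le_sum (f := fun i => u i * u i) (fun i _ => mul_self_nonneg _)
      (Finset.mem_univ i)
  nlinarith

/-- Gives the lower bound needed to compare the real `sInf` in `minValue` with its members. -/
theorem J_nonneg {M N p : ℕ} {α ν γ : ℝ} (hα : 0 ≤ α) (hν : 0 ≤ ν) (hγ : 0 ≤ γ)
    (Y : Matrix (Fin M) (Fin N) ℝ) (U : Matrix (Fin M) (Fin p) ℝ)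
    (S : Matrix (Fin p) (Fin p) ℝ) (V : Matrix (Fin p) (Fin N) ℝ) :
    0 ≤ J α ν γ Y U S V := by
  have h : ∀ {m n : ℕ} (A : Matrix (Fin m) (Fin n) ℝ), 0 ≤ entryNorm A := fun A =>
    Finset.sum_nonneg fun _ _ => Finset.sum_nonneg fun _ _ => abs_nonneg _
  have := mul_nonneg hγ (h S)
  have := mul_nonneg hν (h U)
  have := mul_nonneg hν (h V)
  have := mul_nonneg hα (h (Uᵀ * U - 1))
  have := mul_nonneg hα (h (V * Vᵀ - 1))
  unfold J
  positivity

theorem minOverRank_le_J {M N p : ℕ} (hp : p ∈ Finset.Icc 1 (min N M)) {α ν γ : ℝ} (hα : 0 ≤ α)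
    (hν : 0 ≤ ν) (hγ : 0 ≤ γ) (Y : Matrix (Fin M) (Fin N) ℝ) {U : Matrix (Fin M) (Fin p) ℝ}
    {S : Matrix (Fin p) (Fin p) ℝ} {V : Matrix (Fin p) (Fin N) ℝ} (hU : IsNonneg U)
    (hS : IsNonneg S) (hV : IsNonneg V) : minOverRank α ν γ Y ≤ J α ν γ Y U S V := by
  refine (ciInf_le (Set.finite_range _).bddBelow (⟨p, hp⟩ : Finset.Icc 1 (min N M))).trans ?_
  refine csInf_le ⟨0, ?_⟩ ⟨U, S, V, hU, hS, hV, rfl⟩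
  rintro r ⟨U', S', V', -, -, -, rfl⟩
  exact J_nonneg hα hν hγ Y U' S' V'

/-- Approximating the data by a rank one matrix bounds the minimum over the inner dimension. -/
theorem minOverRank_le_rank_one {M N : ℕ} (hM : 0 < M) (hN : 0 < N) {α ν γ : ℝ} (hα : 0 ≤ α)
    (hν : 0 ≤ ν) (hγ : 0 ≤ γ) (Y : Matrix (Fin M) (Fin N) ℝ) (x : Fin M → ℝ) (y : Fin N → ℝ)
    (hx0 : ∀ i, 0 ≤ x i) (hx1 : ∀ i, x i ≤ 1) (hy0 : ∀ i, 0 ≤ y i) (hy1 : ∀ i, y i ≤ 1) :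
    minOverRank α ν γ Y ≤ ∑ i, ∑ j, (Y i j - x i * y j) ^ 2 + (γ + 2 * ν) * (M * N) := by
  obtain ⟨s, u, hs0, hsM, hu0, hu, hxu⟩ := exists_unit_direction hM x hx0 hx1
  obtain ⟨t, v, ht0, htN, hv0, hv, hyv⟩ := exists_unit_direction hN y hy0 hy1
  have hM1 : (1 : ℝ) ≤ M := by exact_mod_cast hM
  have hN1 : (1 : ℝ) ≤ N := by exact_mod_cast hN
  -- Unit vectors make both Gram matrices the `1 × 1` identity, so `α` may be arbitrarily large.
  let U : Matrix (Fin M) (Fin 1) ℝ := Matrix.of fun i _ => u i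
  let S : Matrix (Fin 1) (Fin 1) ℝ := Matrix.of fun _ _ => s * t
  let V : Matrix (Fin 1) (Fin N) ℝ := Matrix.of fun _ j => v j
  refine (minOverRank_le_J (p := 1) (Finset.mem_Icc.2 ⟨le_rfl, le_min hN hM⟩) hα hν hγ Y
    (U := U) (S := S) (V := V) (fun i _ => hu0 i) (fun _ _ => mul_nonneg hs0 ht0)
    (fun _ j => hv0 j)).trans ?_
  have hUU : Uᵀ * U - 1 = 0 := by
    ext a b
    obtain rfl := Subsingleton.elim a b
    simp [Matrix.mul_apply, U, hu]
  have hVV : V * Vᵀ - 1 = 0 := by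
    ext a b
    obtain rfl := Subsingleton.elim a b
    simp [Matrix.mul_apply, V, hv]
  have hfrob : frobNorm (Y - U * S * V) ^ 2 = ∑ i, ∑ j, (Y i j - x i * y j) ^ 2 := by
    unfold frobNorm
    rw [Real.sq_sqrt (Finset.sum_nonneg fun _ _ => Finset.sum_nonneg fun _ _ => by positivity)]
    refine Finset.sum_congr rfl fun i _ => Finset.sum_congr rfl fun j _ => ?_
    rw [sq_abs]
    congr 1
    simp only [Matrix.sub_apply, Matrix.mul_apply, Finset.univ_unique, Finset.sum_singleton, U, S,
      V, Matrix.of_apply, hxu i, hyv j]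
    ring
  -- All three norms are bounded by the same `M * N`, which produces the coefficient `γ + 2 * ν`.
  have hSn : entryNorm S ≤ M * N := by
    simp only [entryNorm, S, Matrix.of_apply, Finset.univ_unique, Finset.sum_singleton,
      abs_of_nonneg (mul_nonneg hs0 ht0)]
    gcongr
  have hUn : entryNorm U ≤ M * N := by
    have : entryNorm U ≤ M := by
      simp only [entryNorm, U, Matrix.of_apply, Finset.univ_unique, Finset.sum_singleton]
      calc ∑ i, |u i| ≤ ∑ _i : Fin M, (1 : ℝ) := Finset.sum_le_sum fun i _ => by
            rw [abs_of_nonneg (hu0 i)]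
            exact le_one_of_sum_mul_self hu i
        _ = M := by simp
    nlinarith
  have hVn : entryNorm V ≤ M * N := by
    have : entryNorm V ≤ N := by
      simp only [entryNorm, V, Matrix.of_apply, Finset.univ_unique, Finset.sum_singleton]
      calc ∑ i, |v i| ≤ ∑ _i : Fin N, (1 : ℝ) := Finset.sum_le_sum fun i _ => by
            rw [abs_of_nonneg (hv0 i)]
            exact le_one_of_sum_mul_self hv i
        _ = N := by simp
    nlinarith
  have h0 : ∀ k : ℕ, entryNorm (0 : Matrix (Fin k) (Fin k) ℝ) = 0 := fun k => by simp [entryNorm]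
  unfold J
  rw [hUU, hVV, hfrob, h0]
  have := mul_le_mul_of_nonneg_left hSn hγ
  have := mul_le_mul_of_nonneg_left hUn hν
  have := mul_le_mul_of_nonneg_left hVn hν
  linarith

/-! ### Comparison of the claimed bound with the grid probability -/

/-- The numerical inequality behind the probability bound. -/
theorem rank_bound_le {n m : ℕ} (hn : 2 ≤ n) (hnm : n ≤ m) {c ε p e : ℝ} (hc0 : 0 < c)
    (hc1 : c ≤ 1) (hε : 0 < ε) (hεmn : ε * (m * n) ≤ 1) (hp0 : 0 ≤ p) (hp : p ≤ Real.sqrt m)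
    (he : (m : ℝ) * (n - 1) ≤ e) :
    n * p ^ m * (c / 4 * ε) ^ e ≤ c ^ m * (Real.sqrt ε / 2) ^ (m * (n - 1)) := by
  have hn2 : (2 : ℝ) ≤ n := by exact_mod_cast hn
  have hm2 : (2 : ℝ) ≤ m := by exact_mod_cast hn.trans hnm
  have hmn1 : (1 : ℝ) ≤ m * n := by nlinarith
  have hε1 : ε ≤ 1 := by nlinarith
  set r := Real.sqrt ε with hr
  have hr0 : 0 < r := Real.sqrt_pos.2 hε
  have hr1 : r ≤ 1 := Real.sqrt_le_one.2 hε1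
  have hrr : r * r = ε := Real.mul_self_sqrt hε.le
  have hmk : m ≤ m * (n - 1) := Nat.le_mul_of_pos_right m (by omega)
  have hcast : ((m * (n - 1) : ℕ) : ℝ) = m * (n - 1) := by
    rw [Nat.cast_mul, Nat.cast_sub (by omega), Nat.cast_one]
  set k := m * (n - 1)
  have hstep : (c / 4 * ε) ^ e ≤ (c / 4 * ε) ^ k := by
    rw [← Real.rpow_natCast, hcast]
    exact Real.rpow_le_rpow_of_exponent_ge (by positivity) (by nlinarith) he
  -- Of the two factors `r = √ε` in `ε`, one gives the target `(r / 2) ^ k`; the other is spent on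
  -- the prefactor `n * p ^ m`.
  have hsplit : (c / 4 * ε) ^ k = r ^ k * (c / 2 ) ^ k * (r / 2) ^ k := by
    rw [← mul_pow, ← mul_pow, ← hrr]
    ring
  -- `p * r ≤ √(m * ε) ≤ 1 / √n`, and since `m ≥ 2` the power `(p * r) ^ m` is at most `1 / n`.
  have hsmall : n * (p ^ m * r ^ m) ≤ 1 := by
    have hz : p * r ≤ 1 / Real.sqrt n := by
      calc p * r ≤ Real.sqrt m * Real.sqrt ε := by gcongr
        _ = Real.sqrt (m * ε) := (Real.sqrt_mul (by positivity) _).symm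
        _ ≤ Real.sqrt (1 / n) := by
          apply Real.sqrt_le_sqrt
          rw [le_div_iff₀ (by positivity)]
          linarith
        _ = 1 / Real.sqrt n := by rw [Real.sqrt_div zero_le_one, Real.sqrt_one]
    have hz1 : p * r ≤ 1 := hz.trans (by
      rw [div_le_one (by positivity)]
      exact Real.one_le_sqrt.2 (by linarith))
    calc n * (p ^ m * r ^ m) = n * (p * r) ^ m := by rw [mul_pow]
      _ ≤ n * (p * r) ^ 2 := by
        gcongr n * ?_
        exact pow_le_pow_of_le_one (by positivity) hz1 (hn.trans hnm)
      _ ≤ n * (1 / Real.sqrt n) ^ 2 := by gcongr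
      _ = 1 := by
        rw [div_pow, one_pow, Real.sq_sqrt (by positivity)]
        field_simp
  calc n * p ^ m * (c / 4 * ε) ^ e ≤ n * p ^ m * (r ^ k * (c / 2) ^ k * (r / 2) ^ k) := by
        rw [← hsplit]
        gcongr
    _ = (n * (p ^ m * r ^ k)) * ((c / 2) ^ k * (r / 2) ^ k) := by ring
    _ ≤ 1 * (c ^ m * (r / 2) ^ k) := by
        have h1 : n * (p ^ m * r ^ k) ≤ 1 := le_trans (by
          gcongr n * (p ^ m * ?_)
          exact pow_le_pow_of_le_one hr0.le hr1 hmk) hsmall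
        have h2 : (c / 2) ^ k ≤ c ^ m :=
          (pow_le_pow_left₀ (by positivity) (by linarith) k).trans
            (pow_le_pow_of_le_one hc0.le hc1 hmk)
        gcongr
    _ = _ := one_mul _

/-! ### Grid boxes and their probabilities -/

/-- The half-open grid box of side length `1 / q` with index `k`. -/
def gridBox {N q : ℕ} (k : Fin N → Fin q) : Set (Fin N → ℝ) :=
  Set.univ.pi fun j => Set.Ico ((k j : ℝ) / q) (((k j : ℝ) + 1) / q)

theorem measurableSet_gridBox {N q : ℕ} (k : Fin N → Fin q) : MeasurableSet (gridBox k) :=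
  MeasurableSet.univ_pi fun _ => measurableSet_Ico

theorem gridBox_subset_Icc {N q : ℕ} (k : Fin N → Fin q) : gridBox k ⊆ Set.Icc 0 1 := by
  intro y hy
  have hb : ∀ j, 0 ≤ y j ∧ y j ≤ 1 := fun j => by
    obtain ⟨h1, h2⟩ := hy j (Set.mem_univ j)
    have hk : ((k j : ℕ) : ℝ) + 1 ≤ q := by exact_mod_cast (k j).2
    have hq : (0 : ℝ) < q := by exact_mod_cast (k j).pos
    exact ⟨le_trans (by positivity) h1, h2.le.trans ((div_le_one hq).2 hk)⟩
  exact ⟨fun j => (hb j).1, fun j => (hb j).2⟩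

/-- Half-open sides make the disjointness exact, so probabilities of grid events simply add. -/
theorem disjoint_gridBox {N q : ℕ} {k l : Fin N → Fin q} (h : k ≠ l) :
    Disjoint (gridBox k) (gridBox l) := by
  refine Set.disjoint_left.2 fun y hk hl => h (funext fun j => ?_)
  have hq : (0 : ℝ) < q := by exact_mod_cast (k j).pos
  obtain ⟨h1, h2⟩ := hk j (Set.mem_univ j)
  obtain ⟨h3, h4⟩ := hl j (Set.mem_univ j)
  have a1 : ((k j : ℕ) : ℝ) < (l j : ℕ) + 1 := (div_lt_div_iff_of_pos_right hq).1 (h1.trans_lt h4)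
  have a2 : ((l j : ℕ) : ℝ) < (k j : ℕ) + 1 := (div_lt_div_iff_of_pos_right hq).1 (h3.trans_lt h2)
  norm_cast at a1 a2
  exact Fin.ext (by omega)

theorem ofReal_le_withDensity_gridBox {N q : ℕ} (k : Fin N → Fin q) {c : ℝ} (hc : 0 ≤ c)
    {f : (Fin N → ℝ) → ℝ} (hf : ∀ x ∈ Set.Icc (0 : Fin N → ℝ) 1, c ≤ f x) :
    ENNReal.ofReal (c * (1 / q) ^ N) ≤ ((volume : Measure (Fin N → ℝ)).restrict
      (Set.Icc 0 1)).withDensity (fun x => ENNReal.ofReal (f x)) (gridBox k) := by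
  have hm := measurableSet_gridBox k
  have hvol : volume (gridBox k) = ENNReal.ofReal ((1 / q) ^ N) := by
    rw [gridBox, Real.volume_pi_Ico, ← ENNReal.ofReal_prod_of_nonneg]
    · simp [← sub_div]
    · intro j _
      rw [← sub_div]
      simp
  rw [withDensity_apply _ hm, Measure.restrict_restrict hm,
    Set.inter_eq_left.2 (gridBox_subset_Icc k), ENNReal.ofReal_mul hc, ← hvol,
    ← setLIntegral_const]
  exact setLIntegral_mono' hm fun x hx => ENNReal.ofReal_le_ofReal (hf x (gridBox_subset_Icc k hx))

/-- A lower bound for the probability that all entries of a random matrix with independent rows lie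
in the grid boxes described by one member of an injective family. -/
theorem card_mul_le_measureReal_gridBox {M N q : ℕ} {c : ℝ} (hc : 0 ≤ c)
    {f : (Fin N → ℝ) → ℝ} (hf : ∀ x ∈ Set.Icc (0 : Fin N → ℝ) 1, c ≤ f x)
    {Ω : Type*} [MeasurableSpace Ω] (P : Measure Ω) [IsProbabilityMeasure P]
    {X : Fin M → Ω → (Fin N → ℝ)} (hX : ∀ i, Measurable (X i)) (hind : iIndepFun X P)
    (hlaw : ∀ i, P.map (X i) = ((volume : Measure (Fin N → ℝ)).restrict
      (Set.Icc 0 1)).withDensity (fun x => ENNReal.ofReal (f x)))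
    {ι : Type*} [Fintype ι] {k : ι → Fin M → Fin N → Fin q} (hk : Function.Injective k) :
    Fintype.card ι * (c * (1 / q) ^ N) ^ M ≤ P.real {ω | ∃ a, ∀ i, X i ω ∈ gridBox (k a i)} := by
  have hset : {ω | ∃ a, ∀ i, X i ω ∈ gridBox (k a i)} =
      ⋃ a, ⋂ i, X i ⁻¹' gridBox (k a i) := by
    ext ω
    simp
  have hbox : ∀ a i, MeasurableSet (X i ⁻¹' gridBox (k a i)) := fun a i =>
    hX i (measurableSet_gridBox _)
  rw [hset, measureReal_iUnion_fintype _ fun a => MeasurableSet.iInter (hbox a)]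
  · have hterm : ∀ a, (c * (1 / q) ^ N) ^ M ≤ P.real (⋂ i, X i ⁻¹' gridBox (k a i)) := fun a => by
      rw [measureReal_def,
        hind.meas_iInter fun i => ⟨_, measurableSet_gridBox (k a i), rfl⟩, ENNReal.toReal_prod]
      calc (c * (1 / q) ^ N) ^ M = ∏ _i : Fin M, c * (1 / q) ^ N := by simp
        _ ≤ _ := Finset.prod_le_prod (fun _ _ => by positivity) fun i _ => by
          rw [← ENNReal.ofReal_le_iff_le_toReal (measure_ne_top _ _),
            ← Measure.map_apply (hX i) (measurableSet_gridBox _), hlaw i]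
          exact ofReal_le_withDensity_gridBox _ hc hf
    calc Fintype.card ι * (c * (1 / q) ^ N) ^ M = ∑ _a : ι, (c * (1 / q) ^ N) ^ M := by simp
      _ ≤ _ := Finset.sum_le_sum fun a _ => hterm a
  -- Two distinct members of the family differ in some row, and the boxes of that row are disjoint.
  · intro a b hab
    obtain ⟨i, hi⟩ := Function.ne_iff.1 (hk.ne hab)
    exact ((disjoint_gridBox hi).preimage (X i)).mono (Set.iInter_subset _ i)
      (Set.iInter_subset _ i)

/-- If the grid index of the entries depends on the row only or on the column only, the minimum over
the inner dimension is small. -/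
theorem minOverRank_lt_of_mem_gridBox {M N q : ℕ} (hM : 0 < M) (hN : 0 < N) {α ν γ ε δ : ℝ}
    (hα : 0 ≤ α) (hν : 0 ≤ ν) (hγ : 0 ≤ γ) (hε : (1 / q : ℝ) ^ 2 ≤ ε)
    (hδ : (ε + (γ + 2 * ν)) * (M * N) < δ) {Y : Matrix (Fin M) (Fin N) ℝ}
    {k : Fin M → Fin N → Fin q} (hY : ∀ i, Y i ∈ gridBox (k i))
    (hk : (∃ a : Fin M → Fin q, ∀ i j, k i j = a i) ∨
      ∃ b : Fin N → Fin q, ∀ i j, k i j = b j) :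
    minOverRank α ν γ Y < δ := by
  have hb : ∀ a : Fin q, (0 : ℝ) ≤ (a : ℝ) / q ∧ (a : ℝ) / q ≤ 1 := fun a => by
    have h1 : ((a : ℕ) : ℝ) ≤ q := by exact_mod_cast a.2.le
    exact ⟨by positivity, div_le_one_of_le₀ h1 (by positivity)⟩
  -- The lower corners of the cells form a rank one matrix: one factor is constantly `1`, the other
  -- lists the corners.
  obtain ⟨x, y, hx0, hx1, hy0, hy1, hxy⟩ : ∃ (x : Fin M → ℝ) (y : Fin N → ℝ), (∀ i, 0 ≤ x i) ∧
      (∀ i, x i ≤ 1) ∧ (∀ j, 0 ≤ y j) ∧ (∀ j, y j ≤ 1) ∧ ∀ i j, x i * y j = (k i j : ℝ) / q := by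
    rcases hk with ⟨a, ha⟩ | ⟨b, hb'⟩
    · exact ⟨fun i => (a i : ℝ) / q, fun _ => 1, fun i => (hb _).1, fun i => (hb _).2,
        fun _ => zero_le_one, fun _ => le_rfl, fun i j => by rw [ha, mul_one]⟩
    · exact ⟨fun _ => 1, fun j => (b j : ℝ) / q, fun _ => zero_le_one, fun _ => le_rfl,
        fun j => (hb _).1, fun j => (hb _).2, fun i j => by rw [hb', one_mul]⟩
  refine (minOverRank_le_rank_one hM hN hα hν hγ Y x y hx0 hx1 hy0 hy1).trans_lt ?_
  have hsum : ∑ i, ∑ j, (Y i j - x i * y j) ^ 2 ≤ ε * (M * N) := by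
    calc ∑ i, ∑ j, (Y i j - x i * y j) ^ 2 ≤ ∑ _i : Fin M, ∑ _j : Fin N, ε := by
          refine Finset.sum_le_sum fun i _ => Finset.sum_le_sum fun j _ => ?_
          obtain ⟨h1, h2⟩ := hY i j (Set.mem_univ j)
          rw [add_div] at h2
          rw [hxy]
          exact (pow_le_pow_left₀ (by linarith) (by linarith) 2).trans hε
      _ = ε * (M * N) := by
          simp
          ring
  linarith

/-! ### Estimates for `eps`, `rankChoice` and `mu` -/

theorem eps_pos {K δ : ℝ} {N M : ℕ} (hK : 1 < K) (hδ : 0 < δ) (hN : 0 < N) (hM : 0 < M) :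
    0 < eps K N M δ := by
  have : 0 < K := by linarith
  unfold eps
  positivity

theorem log_mul_eps {C K δ : ℝ} {N M : ℕ} (hC : 0 < C) (hK : 1 < K) (hδ : 0 < δ) (hN : 0 < N)
    (hM : 0 < M) : Real.log (C * eps K N M δ) =
      Real.log C + Real.log δ - Real.log (K * N * M + (min N M : ℕ) ^ 2) := by
  have : 0 < K := by linarith
  have hD : (0 : ℝ) < K * N * M + (min N M : ℕ) ^ 2 := by positivity
  rw [eps, Real.log_mul hC.ne' (by positivity), Real.log_mul hδ.ne' (by positivity), Real.log_inv]
  ring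

theorem eps_mul_le {K δ : ℝ} {N M : ℕ} (hK : 1 < K) (hδ : 0 < δ) (hN : 0 < N) (hM : 0 < M) :
    eps K N M δ * (N * M) ≤ δ := by
  have : 0 < K := by linarith
  have hN' : (0 : ℝ) < N := by exact_mod_cast hN
  have hM' : (0 : ℝ) < M := by exact_mod_cast hM
  have hD : (0 : ℝ) < K * N * M + (min N M : ℕ) ^ 2 := by positivity
  rw [eps, mul_assoc, inv_mul_eq_div]
  refine mul_le_of_le_one_right hδ.le ((div_le_one hD).2 ?_)
  nlinarith [mul_pos hN' hM', sq_nonneg ((min N M : ℕ) : ℝ)]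

theorem mul_eps_le {C K δ : ℝ} {N M : ℕ} (hC : 0 < C) (hC1 : C ≤ 1 / 4) (hK : 1 < K)
    (hδ : 0 < δ) (hδ1 : δ < 1) (hN : 0 < N) (hM : 0 < M) : C * eps K N M δ ≤ 1 / 4 := by
  have h := eps_mul_le hK hδ hN hM
  have he := eps_pos hK hδ hN hM
  have : (1 : ℝ) ≤ N * M := by exact_mod_cast Nat.mul_pos hN hM
  nlinarith

/-- Holds because `e < 4`; it makes the denominator in `rankChoice` at least `1`. -/
theorem one_le_abs_log {t : ℝ} (h0 : 0 < t) (h1 : t ≤ 1 / 4) : 1 ≤ |Real.log t| := by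
  have : Real.log t ≤ -1 := by
    rw [Real.log_le_iff_le_exp h0, Real.exp_neg]
    refine h1.trans ?_
    rw [one_div]
    exact inv_anti₀ (Real.exp_pos 1) (Real.exp_one_lt_d9.le.trans (by norm_num))
  exact le_abs.2 (Or.inr (by linarith))

theorem rankChoice_eq {C K δ : ℝ} {N M : ℕ} (hC : 0 < C) (hC1 : C ≤ 1 / 4) (hK : 1 < K)
    (hδ : 0 < δ) (hδ1 : δ < 1) (hN : 0 < N) (hM : 0 < M) :
    rankChoice C K N M δ = Real.sqrt ((max M N : ℕ) /
      (Real.log (K * N * M + (min N M : ℕ) ^ 2) + |Real.log δ| - Real.log C)) := by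
  have ht := mul_eps_le hC hC1 hK hδ hδ1 hN hM
  have h0 := mul_pos hC (eps_pos hK hδ hN hM)
  rw [rankChoice, abs_of_nonpos (Real.log_nonpos h0.le (by linarith)),
    abs_of_nonpos (Real.log_nonpos hδ.le hδ1.le), log_mul_eps hC hK hδ hN hM]
  congr 2
  ring

theorem rankChoice_le_sqrt {C K δ : ℝ} {N M : ℕ} (hC : 0 < C) (hC1 : C ≤ 1 / 4) (hK : 1 < K)
    (hδ : 0 < δ) (hδ1 : δ < 1) (hN : 0 < N) (hM : 0 < M) :
    rankChoice C K N M δ ≤ Real.sqrt (max N M : ℕ) := by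
  have h1 := one_le_abs_log (mul_pos hC (eps_pos hK hδ hN hM))
    (mul_eps_le hC hC1 hK hδ hδ1 hN hM)
  rw [rankChoice, max_comm]
  exact Real.sqrt_le_sqrt (div_le_self (by positivity) h1)

/-- The difference of the two sides is `l * (l - 1) / 2 + min N M - 1`, and `l * (l - 1) / 2 ≥ -1 /
8`. -/
theorem max_mul_min_sub_one_le_mu {N M : ℕ} (hN : 2 ≤ N) (hM : 2 ≤ M) (l : ℝ) :
    ((max N M : ℕ) : ℝ) * ((min N M : ℕ) - 1) ≤ mu N M l := by
  have hN' : (2 : ℝ) ≤ N := by exact_mod_cast hN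
  have hM' : (2 : ℝ) ≤ M := by exact_mod_cast hM
  unfold mu
  rcases le_total N M with h | h
  · have h' : (N : ℝ) ≤ M := by exact_mod_cast h
    rw [max_eq_right h, min_eq_left h, abs_of_nonpos (by linarith)]
    nlinarith [sq_nonneg (l - 1 / 2)]
  · have h' : (M : ℝ) ≤ N := by exact_mod_cast h
    rw [max_eq_left h, min_eq_right h, abs_of_nonneg (by linarith)]
    nlinarith [sq_nonneg (l - 1 / 2)]

/-! ### Choice of the grid -/

/-- The probability of a grid of mesh comparable to `√ε` aligned with the longer dimension. -/
theorem pow_le_card_mul {N M q : ℕ} (hN : 0 < N) (hM : 0 < M) {c r : ℝ} (hc0 : 0 < c)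
    (hc1 : c ≤ 1) (hr : 0 ≤ r) (hq : 0 < q) (hrq : r ≤ 1 / q) :
    c ^ max N M * r ^ (max N M * (min N M - 1)) ≤
      (q : ℝ) ^ max N M * (c * (1 / q) ^ N) ^ M := by
  have hq' : (0 : ℝ) < q := by exact_mod_cast hq
  -- The `q ^ max N M` choices cancel exactly this many of the `N * M` factors `1 / q`.
  have hNM : N * M = max N M * (min N M - 1) + max N M := by
    rw [← max_mul_min N M, ← Nat.mul_succ, Nat.succ_eq_add_one,
      Nat.sub_add_cancel (Nat.one_le_iff_ne_zero.2 (lt_min hN hM).ne')]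
  have hrw : (q : ℝ) ^ max N M * (c * (1 / q) ^ N) ^ M =
      c ^ M * (1 / q : ℝ) ^ (max N M * (min N M - 1)) := by
    rw [mul_pow, ← pow_mul, hNM, pow_add]
    have : (q : ℝ) ^ max N M * (1 / q) ^ max N M = 1 := by
      rw [← mul_pow, mul_one_div_cancel hq'.ne', one_pow]
    linear_combination (c ^ M * (1 / q : ℝ) ^ (max N M * (min N M - 1))) * this
  rw [hrw]
  gcongr ?_ * ?_
  · exact pow_le_pow_of_le_one hc0.le hc1 (le_max_right N M)
  · exact pow_le_pow_left₀ hr hrq _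

/-- A family of grid indices of size `q ^ max N M`, constant along the shorter dimension. -/
theorem exists_aligned_family {N M : ℕ} (hN : 0 < N) (hM : 0 < M) (q : ℕ) :
    ∃ k : (Fin (max N M) → Fin q) → Fin M → Fin N → Fin q, Function.Injective k ∧
      ∀ s, (∃ a : Fin M → Fin q, ∀ i j, k s i j = a i) ∨
        ∃ b : Fin N → Fin q, ∀ i j, k s i j = b j := by
  rcases le_total N M with h | h
  · rw [max_eq_right h]
    exact ⟨fun s i _ => s i, fun s t hst => funext fun i => congrFun (congrFun hst i) ⟨0, hN⟩,
      fun s => Or.inl ⟨s, fun _ _ => rfl⟩⟩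
  · rw [max_eq_left h]
    exact ⟨fun s _ j => s j, fun s t hst => funext fun j => congrFun (congrFun hst ⟨0, hM⟩) j,
      fun s => Or.inr ⟨s, fun _ _ => rfl⟩⟩

/-- Take `q = ⌈1 / √ε⌉`; as `√ε ≤ 1`, rounding up at most doubles, since `1 / √ε + 1 ≤ 2 / √ε`. -/
theorem exists_mesh {ε : ℝ} (hε : 0 < ε) (hε1 : ε ≤ 1) :
    ∃ q : ℕ, 0 < q ∧ (1 / q : ℝ) ^ 2 ≤ ε ∧ Real.sqrt ε / 2 ≤ 1 / q := by
  have hr0 : 0 < Real.sqrt ε := Real.sqrt_pos.2 hε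
  have hr1 : Real.sqrt ε ≤ 1 := Real.sqrt_le_one.2 hε1
  have hq : 0 < ⌈1 / Real.sqrt ε⌉₊ := Nat.ceil_pos.2 (by positivity)
  have hq' : (0 : ℝ) < ⌈1 / Real.sqrt ε⌉₊ := by exact_mod_cast hq
  refine ⟨⌈1 / Real.sqrt ε⌉₊, hq, ?_, ?_⟩
  · refine (pow_le_pow_left₀ (by positivity) ?_ 2).trans_eq (Real.sq_sqrt hε.le)
    rw [one_div_le hq' hr0]
    exact Nat.le_ceil _
  · rw [le_one_div (by positivity) hq', one_div_div]
    refine (Nat.ceil_lt_add_one (by positivity)).le.trans ?_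
    rw [div_add_one hr0.ne']
    gcongr
    linarith

/-! ### Asymptotics for square matrices -/

theorem isEquivalent_rankChoice {C K δ : ℝ} (hC : 0 < C) (hK : 1 < K) (hδ : 0 < δ) :
    (fun N : ℕ => rankChoice C K N N δ) ~[atTop]
      (fun N : ℕ => Real.sqrt (N / (2 * Real.log N))) := by
  have hK0 : 0 < K := by linarith
  set a : ℝ := Real.log C + Real.log δ - Real.log (K + 1)
  have hlog : Tendsto (fun N : ℕ => Real.log N) atTop atTop :=
    Real.tendsto_log_atTop.comp tendsto_natCast_atTop_atTop
  -- For `M = N` the logarithm is `a - 2 * log N` with `a` constant, so this is the ratio of the two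
  -- sequences.
  have hlim : Tendsto (fun N : ℕ => Real.sqrt (1 / |a / (2 * Real.log N) - 1|)) atTop (nhds 1) := by
    have h0 : Tendsto (fun N : ℕ => a / (2 * Real.log N)) atTop (nhds 0) :=
      Tendsto.const_div_atTop (hlog.const_mul_atTop two_pos) a
    have h1 : Tendsto (fun N : ℕ => |a / (2 * Real.log N) - 1|) atTop (nhds 1) := by
      simpa using (h0.sub_const 1).abs
    simpa using ((h1.inv₀ one_ne_zero).sqrt)
  refine (isEquivalent_iff_exists_eq_mul).2 ⟨_, hlim, ?_⟩
  filter_upwards [hlog.eventually_gt_atTop 0, eventually_gt_atTop 0] with N hlN hN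
  have hN' : (0 : ℝ) < N := by exact_mod_cast hN
  have hlogeps : Real.log (C * eps K N N δ) =
      (2 * Real.log N) * (a / (2 * Real.log N) - 1) := by
    have hD : K * N * N + ((min N N : ℕ) : ℝ) ^ 2 = (K + 1) * (N : ℝ) ^ 2 := by
      rw [min_self]
      ring
    rw [log_mul_eps hC hK hδ hN hN, hD, Real.log_mul (by positivity) (by positivity), Real.log_pow]
    field_simp
    simp only [a]
    push_cast
    ring
  rw [Pi.mul_apply, rankChoice, hlogeps, abs_mul, abs_of_pos (by positivity : 0 < 2 * Real.log N),
    max_self, ← Real.sqrt_mul (by positivity)]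
  congr 1
  rw [one_div_mul_eq_div, div_div]

end TriFactorization
-- The main theorem
theorem mainTheorem1 (C₁ C₂ : ℝ) (hC₁ : 0 < C₁) :
    ∃ C₃ : ℝ, 0 < C₃ ∧ ∃ δ₀ : ℝ, 0 < δ₀ ∧
      (∀ N M : ℕ, 2 ≤ N → 2 ≤ M → ∀ K : ℝ, 1 < K → ∀ δ : ℝ, 0 < δ → δ < δ₀ →
        TriFactorization.rankChoice C₃ K N M δ =
            Real.sqrt ((max M N : ℕ) /
              (Real.log (K * N * M + (min N M : ℕ) ^ 2) + |Real.log δ| - Real.log C₃)) ∧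
        ∀ α ν γ : ℝ, 0 ≤ α → 0 ≤ ν → 0 ≤ γ →
          γ + 2 * ν ≤ (K - 1) * TriFactorization.eps K N M δ →
        ∀ (Ω : Type*) [MeasurableSpace Ω] (P : Measure Ω) [IsProbabilityMeasure P]
          (X : Fin M → Ω → (Fin N → ℝ)) (f : (Fin N → ℝ) → ℝ),
          Measurable f →
          (∀ x ∈ Set.Icc (0 : Fin N → ℝ) 1, C₁ < f x ∧ f x < C₂) →
          (∀ i, Measurable (X i)) →
          iIndepFun X P →
          (∀ i, P.map (X i) =
            ((volume : Measure (Fin N → ℝ)).restrict (Set.Icc 0 1)).withDensity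
              (fun x => ENNReal.ofReal (f x))) →
          (min N M : ℕ) * TriFactorization.rankChoice C₃ K N M δ ^ (max N M) *
              (C₃ * TriFactorization.eps K N M δ) ^
                (TriFactorization.mu N M (TriFactorization.rankChoice C₃ K N M δ)) ≤
            P.real {ω | TriFactorization.minOverRank α ν γ
              (Matrix.of fun i j => X i ω j) < δ}) ∧
      (∀ K : ℝ, 1 < K → ∀ δ : ℝ, 0 < δ →
        (fun N : ℕ => TriFactorization.rankChoice C₃ K N N δ) ~[atTop]
          (fun N : ℕ => Real.sqrt (N / (2 * Real.log N)))) := by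
  -- Capping at `1` lets powers of `c` decrease in the exponent. The constants are `C₃ = c / 4` and
  -- `δ₀ = 1`.
  set c : ℝ := min C₁ 1
  have hc0 : 0 < c := lt_min hC₁ one_pos
  have hc1 : c ≤ 1 := min_le_right _ _
  have hC0 : 0 < c / 4 := by positivity
  have hC1 : c / 4 ≤ 1 / 4 := by linarith
  refine ⟨c / 4, hC0, 1, one_pos, ?_, fun K hK δ hδ =>
    TriFactorization.isEquivalent_rankChoice hC0 hK hδ⟩
  intro N M hN hM K hK δ hδ hδ1
  have hN0 : 0 < N := by omega
  have hM0 : 0 < M := by omega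
  refine ⟨TriFactorization.rankChoice_eq hC0 hC1 hK hδ hδ1 hN0 hM0, ?_⟩
  intro α ν γ hα hν hγ hpen Ω _ P _ X f _ hf hX hind hlaw
  have hNM : (1 : ℝ) ≤ N * M := by exact_mod_cast Nat.mul_pos hN0 hM0
  have hε := TriFactorization.eps_pos hK hδ hN0 hM0
  have hεNM := TriFactorization.eps_mul_le hK hδ hN0 hM0
  have hsum : TriFactorization.eps K N M δ * (K * N * M + (min N M : ℕ) ^ 2) = δ :=
    inv_mul_cancel_right₀ (by positivity) δ
  set ε := TriFactorization.eps K N M δ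
  obtain ⟨q, hq0, hqε, hεq⟩ := TriFactorization.exists_mesh hε (by nlinarith)
  obtain ⟨k, hk, hkal⟩ := TriFactorization.exists_aligned_family hN0 hM0 q
  have hmaxmin : ((max N M : ℕ) : ℝ) * (min N M : ℕ) = N * M := by
    exact_mod_cast max_mul_min N M
  have hprob := TriFactorization.card_mul_le_measureReal_gridBox (c := c) hc0.le
    (fun x hx => (min_le_left _ _).trans (hf x hx).1.le) P hX hind hlaw hk
  rw [Fintype.card_fun, Fintype.card_fin, Fintype.card_fin, Nat.cast_pow] at hprob
  refine (TriFactorization.rank_bound_le (le_min hN hM) min_le_max hc0 hc1 hε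
    (by rw [hmaxmin]; linarith) (Real.sqrt_nonneg _)
    (TriFactorization.rankChoice_le_sqrt hC0 hC1 hK hδ hδ1 hN0 hM0)
    (TriFactorization.max_mul_min_sub_one_le_mu hN hM _)).trans ?_
  refine (TriFactorization.pow_le_card_mul hN0 hM0 hc0 hc1 (by positivity) hq0 hεq).trans ?_
  refine hprob.trans (measureReal_mono ?_)
  rintro ω ⟨s, hs⟩
  refine TriFactorization.minOverRank_lt_of_mem_gridBox hM0 hN0 hα hν hγ hqε ?_ hs (hkal s)
  -- By `hsum`, `K * ε * N * M = δ - ε * min ^ 2`; the positive term `ε * min ^ 2` makes the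
  -- inequality strict.
  have hmin : (0 : ℝ) < (min N M : ℕ) := by exact_mod_cast lt_min hN0 hM0
  have := mul_le_mul_of_nonneg_right hpen (by linarith : (0 : ℝ) ≤ N * M)
  have := mul_pos hε (pow_pos hmin 2)
  linarith
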